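/- Let $(R,\mathfrak m,k)$ be a commutative Noetherian local ring, and let $I$ be an integrally closed $\mathfrak m$-primary ideal of $R$; that is, $I$ is a primary ideal with $\sqrt I=\mathfrak m$, and $I$ contains every $r\in R$ satisfying an equation $r^n+a_1r^{n-1}+\cdots+a_n=0$ with $n\ge 1$ and $a_i\in I^i$ for $1\le i\le n$. For a finitely generated $R$-module $M$, let $\operatorname{G-dim}_R(M)$ denote its Gorenstein dimension: the least $n\ge 0$ for which there is an exact sequence $0\to G_n\to\cdots\to G_0\to M\to 0$ with all $G_i$ totally reflexive, $\infty$ if there is no such $n$, and $-\infty$ if $M=0$. Here a finitely generated $R$-module $G$ is totally reflexive if the biduality map $G\to G^{**}$ is an isomorphism and $\operatorname{Ext}^i_R(G,R)=0=\operatorname{Ext}^i_R(G^*,R)$ for all $i\ge 1$, where $(-)^*=\operatorname{Hom}_R(-,R)$. Then $$R \text{ is Gorenstein (i.e. } \operatorname{injdim}_R(R)<\infty) \iff \operatorname{G-dim}_R(I)<\infty \iff \operatorname{G-dim}_R(R/I)<\infty .$$ -/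

import Mathlib

universe u

noncomputable section

open CategoryTheory

/-- `r` is integral over the ideal `I`: it satisfies an equation
`r ^ n + a₁ r ^ (n - 1) + ⋯ + aₙ = 0` with `n ≥ 1` and `aᵢ ∈ I ^ i`. -/
def IsIntegralOverIdeal {R : Type u} [CommRing R] (I : Ideal R) (r : R) : Prop :=
  ∃ n : ℕ, 1 ≤ n ∧ ∃ a : ℕ → R, (∀ i ∈ Finset.Icc 1 n, a i ∈ I ^ i) ∧
    r ^ n + ∑ i ∈ Finset.Icc 1 n, a i * r ^ (n - i) = 0

/-- `I` contains every element of the ring that is integral over `I`. -/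
def IsIntegrallyClosedIdeal {R : Type u} [CommRing R] (I : Ideal R) : Prop :=
  ∀ r : R, IsIntegralOverIdeal I r → r ∈ I

/-- A Noetherian local ring is Gorenstein if it has finite injective dimension over itself. -/
def IsGorensteinLocalRing (R : Type u) [CommRing R] [IsLocalRing R] [IsNoetherianRing R] : Prop :=
  injectiveDimension (ModuleCat.of R R) < ⊤

/-- Totally reflexive modules (modules in the G-class): finitely generated modules `M` such that
the biduality map `M → M**` is bijective and `Extⁱ(M, R) = 0 = Extⁱ(M*, R)` for all `i ≥ 1`. -/
structure IsTotallyReflexive (R : Type u) [CommRing R]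
    (M : Type u) [AddCommGroup M] [Module R M] : Prop where
  finite : Module.Finite R M
  reflexive : Module.IsReflexive R M
  ext_self : ∀ i : ℕ, 1 ≤ i →
    Subsingleton (Abelian.Ext.{u} (ModuleCat.of R M) (ModuleCat.of R R) i)
  ext_dual : ∀ i : ℕ, 1 ≤ i →
    Subsingleton (Abelian.Ext.{u} (ModuleCat.of R (Module.Dual R M)) (ModuleCat.of R R) i)

/-- There is an exact sequence `0 → Gₙ → ⋯ → G₁ → G₀ → M → 0` with every `Gᵢ` totally reflexive
(written as an infinite sequence with `Gᵢ = 0` for `i > n`). -/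
def HasGResolutionOfLength (R : Type u) [CommRing R]
    (M : Type u) [AddCommGroup M] [Module R M] (n : ℕ) : Prop :=
  ∃ (G : ℕ → ModuleCat.{u} R) (d : ∀ i, G (i + 1) →ₗ[R] G i) (ε : G 0 →ₗ[R] M),
    (∀ i, IsTotallyReflexive R (G i)) ∧
    (∀ i, n < i → Subsingleton (G i)) ∧
    Function.Surjective ε ∧
    Function.Exact (d 0) ε ∧
    ∀ i, Function.Exact (d (i + 1)) (d i)

open Classical in
/-- The Gorenstein dimension of a finitely generated module over a Noetherian ring: the least
length of a resolution by totally reflexive modules, `⊤` if there is no such resolution of finite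
length, and `⊥` (that is, `-∞`) for the zero module. -/
def gorensteinDimension (R : Type u) [CommRing R]
    (M : Type u) [AddCommGroup M] [Module R M] : WithBot ℕ∞ :=
  if Subsingleton M then ⊥
  else ⨅ (n : ℕ) (_ : HasGResolutionOfLength R M n), ((n : ℕ∞) : WithBot ℕ∞)

end

/-! Finite G-dimension of `I` or `R ⧸ I` gives `Ext^i(R/I, R) = 0` for large `i`; the point is to
transfer this to the residue field `k`. If `I ≠ m`, integral closedness gives `x ∈ m` and `y ∈ (I :
m)` with `w = xy ∉ mI`. Choose `mI ≤ J ≤ I` with `w ∉ J` and `I = J + (w)`. Multiplication by `w`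
embeds `k` in `R/J` with cokernel `R/I` and factors through `R/I`, so `Ext^i(k, R) = 0` once two
consecutive Ext modules of `R/I` vanish (`extVanishes_residueField_of_extVanishes_quotient`).
Noetherian induction and Baer's criterion then bound the injective dimension of `R`. Conversely,
over a Gorenstein ring a finite module whose positive Ext modules into `R` vanish is totally
reflexive (`isTotallyReflexive_of_extVanishes`), and high syzygies are such modules. -/

section ExtVanishing

open CategoryTheory

variable {R : Type u} [CommRing R]

/-- The module `Extⁱ(N, M)` vanishes. -/
abbrev ExtVanishes (R : Type u) [CommRing R] (N M : Type u) [AddCommGroup N] [Module R N]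
    [AddCommGroup M] [Module R M] (i : ℕ) : Prop :=
  Subsingleton (Abelian.Ext.{u} (ModuleCat.of R N) (ModuleCat.of R M) i)

variable {A B C M : Type u} [AddCommGroup A] [Module R A] [AddCommGroup B] [Module R B]
  [AddCommGroup C] [Module R C] [AddCommGroup M] [Module R M]

lemma shortExact_of_linearMap {f : A →ₗ[R] B} {g : B →ₗ[R] C} (hf : Function.Injective f)
    (hg : Function.Surjective g) (h : Function.Exact f g) :
    (ModuleCat.shortComplexOfCompEqZero f g h.linearMap_comp_eq_zero).ShortExact :=
  ModuleCat.shortComplex_shortExact _ h hf hg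

lemma ExtVanishes.of_projective [Module.Projective R A] (i : ℕ) : ExtVanishes R A M (i + 1) :=
  have : Projective (ModuleCat.of R A) := (IsProjective.iff_projective A).1 ‹_›
  Abelian.Ext.subsingleton_of_projective _ _ i

lemma ExtVanishes.right {f : A →ₗ[R] B} {g : B →ₗ[R] C} (hf : Function.Injective f)
    (hg : Function.Surjective g) (h : Function.Exact f g) {i : ℕ}
    (hA : ExtVanishes R A M i) (hB : ExtVanishes R B M (i + 1)) : ExtVanishes R C M (i + 1) := by
  refine subsingleton_of_forall_eq 0 fun x => ?_
  obtain ⟨y, rfl⟩ := Abelian.Ext.contravariant_sequence_exact₃ (shortExact_of_linearMap hf hg h)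
    _ x (hB.elim _ _) (add_comm 1 i)
  rw [hA.elim y 0, Abelian.Ext.comp_zero]

lemma ExtVanishes.middle {f : A →ₗ[R] B} {g : B →ₗ[R] C} (hf : Function.Injective f)
    (hg : Function.Surjective g) (h : Function.Exact f g) {i : ℕ}
    (hA : ExtVanishes R A M i) (hC : ExtVanishes R C M i) : ExtVanishes R B M i := by
  refine subsingleton_of_forall_eq 0 fun x => ?_
  obtain ⟨y, rfl⟩ := Abelian.Ext.contravariant_sequence_exact₂ (shortExact_of_linearMap hf hg h)
    _ x (hA.elim _ _)
  rw [hC.elim y 0, Abelian.Ext.comp_zero]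

lemma ExtVanishes.left {f : A →ₗ[R] B} {g : B →ₗ[R] C} (hf : Function.Injective f)
    (hg : Function.Surjective g) (h : Function.Exact f g) {i : ℕ}
    (hB : ExtVanishes R B M i) (hC : ExtVanishes R C M (i + 1)) : ExtVanishes R A M i := by
  refine subsingleton_of_forall_eq 0 fun x => ?_
  obtain ⟨y, rfl⟩ := Abelian.Ext.contravariant_sequence_exact₁ (shortExact_of_linearMap hf hg h)
    _ x (add_comm 1 i) (hC.elim _ _)
  rw [hB.elim y 0, Abelian.Ext.comp_zero]

lemma ExtVanishes.of_subsingleton [Subsingleton A] (i : ℕ) : ExtVanishes R A M i := by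
  refine subsingleton_of_forall_eq 0 fun x => ?_
  rw [← Abelian.Ext.mk₀_id_comp x, (ModuleCat.isZero_of_subsingleton _).eq_of_src (𝟙 _) 0,
    Abelian.Ext.mk₀_zero, Abelian.Ext.zero_comp]

lemma ExtVanishes.of_linearEquiv (e : A ≃ₗ[R] B) {i : ℕ} (h : ExtVanishes R A M i) :
    ExtVanishes R B M i :=
  have hzero : ExtVanishes R PUnit.{u + 1} M i := .of_subsingleton i
  .middle (f := e.toLinearMap) (g := (0 : B →ₗ[R] PUnit.{u + 1})) e.injective
    (Function.surjective_to_subsingleton _) ((e.exact_zero_iff_surjective _).2 e.surjective)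
    h hzero

lemma ExtVanishes.of_shift_target {f : A →ₗ[R] B} {g : B →ₗ[R] C} (hf : Function.Injective f)
    (hg : Function.Surjective g) (h : Function.Exact f g) {N : Type u} [AddCommGroup N]
    [Module R N] {i : ℕ} (hB : ExtVanishes R N B i) (hA : ExtVanishes R N A (i + 1)) :
    ExtVanishes R N C i := by
  refine subsingleton_of_forall_eq 0 fun x => ?_
  obtain ⟨y, rfl⟩ := Abelian.Ext.covariant_sequence_exact₃ _ (shortExact_of_linearMap hf hg h)
    x rfl (hA.elim _ _)
  rw [hB.elim y 0, Abelian.Ext.zero_comp]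

lemma ExtVanishes.exists_extension {f : A →ₗ[R] B} {g : B →ₗ[R] C} (hf : Function.Injective f)
    (hg : Function.Surjective g) (h : Function.Exact f g) (hC : ExtVanishes R C M 1)
    (φ : A →ₗ[R] M) : ∃ ψ : B →ₗ[R] M, ψ ∘ₗ f = φ := by
  obtain ⟨ψ, hψ⟩ := Abelian.Ext.contravariant_sequence_exact₁ (shortExact_of_linearMap hf hg h)
    (ModuleCat.of R M) (Abelian.Ext.mk₀ (ModuleCat.ofHom φ)) (add_comm 1 0) (hC.elim _ _)
  obtain ⟨ψ, rfl⟩ := Abelian.Ext.homEquiv₀.symm.surjective ψ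
  refine ⟨ψ.hom, ?_⟩
  have : ModuleCat.ofHom f ≫ ψ = ModuleCat.ofHom φ :=
    Abelian.Ext.homEquiv₀.symm.injective (by simpa using hψ)
  exact congrArg ModuleCat.Hom.hom this

/-- If `A → C` is injective with cokernel `B`, and factors through `B`, then the vanishing of two
consecutive `Ext`-modules of `B` forces the vanishing of one of `A`. -/
lemma ExtVanishes.of_factor {u : A →ₗ[R] B} {v : B →ₗ[R] C} {g : C →ₗ[R] B}
    (hinj : Function.Injective (v ∘ₗ u)) (hg : Function.Surjective g)
    (h : Function.Exact (v ∘ₗ u) g) {i : ℕ} (hi : ExtVanishes R B M i)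
    (hi' : ExtVanishes R B M (i + 1)) : ExtVanishes R A M i := by
  refine subsingleton_of_forall_eq 0 fun x => ?_
  obtain ⟨y, hy⟩ := Abelian.Ext.contravariant_sequence_exact₁
    (shortExact_of_linearMap hinj hg h) _ x (add_comm 1 i) (hi'.elim _ _)
  have hcomp : ModuleCat.ofHom (v ∘ₗ u) = ModuleCat.ofHom u ≫ ModuleCat.ofHom v := rfl
  have key : (Abelian.Ext.mk₀ (ModuleCat.ofHom (v ∘ₗ u))).comp y (zero_add i) = 0 := by
    rw [hcomp, ← Abelian.Ext.mk₀_comp_mk₀_assoc,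
      hi.elim ((Abelian.Ext.mk₀ (ModuleCat.ofHom v)).comp y (zero_add i)) 0,
      Abelian.Ext.comp_zero]
  exact hy.symm.trans key

end ExtVanishing

/-! ### Injective dimension tested on the residue field. -/

section InjectiveDimension

open CategoryTheory

variable {R : Type u} [CommRing R]

/-- Baer's criterion for injective dimension: it can be tested on cyclic modules. -/
lemma hasInjectiveDimensionLT_of_extVanishes (n : ℕ) (M : Type u) [AddCommGroup M] [Module R M]
    (h : ∀ I : Ideal R, ∀ i, n + 1 ≤ i → ExtVanishes R (R ⧸ I) M i) :
    HasInjectiveDimensionLT (ModuleCat.of R M) (n + 1) := by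
  induction n generalizing M with
  | zero =>
    have hB : Module.Baer R M := fun I φ => by
      obtain ⟨ψ, hψ⟩ := (h I 1 le_rfl).exists_extension (f := I.subtype) (g := I.mkQ)
        I.injective_subtype I.mkQ_surjective (LinearMap.exact_subtype_mkQ I) φ
      exact ⟨ψ, fun x hx => LinearMap.congr_fun hψ ⟨x, hx⟩⟩
    have := hB.injective
    have : Injective (ModuleCat.of R M) := Module.injective_object_of_injective_module R M
    infer_instance
  | succ n ih =>
    let J : ModuleCat.{u} R := Injective.under (ModuleCat.of R M)
    have hJ' : HasInjectiveDimensionLT J 1 :=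
      injective_iff_hasInjectiveDimensionLT_one.1 (Injective.injective_under _)
    let f : M →ₗ[R] J := (Injective.ι (ModuleCat.of R M)).hom
    have hf : Function.Injective f := (ModuleCat.mono_iff_injective _).1 inferInstance
    have hex : Function.Exact f (LinearMap.range f).mkQ := LinearMap.exact_map_mkQ_range f
    -- Dimension shift: passing to the cokernel of an embedding into an injective lowers the Ext
    -- degree by one.
    have hC := ih (J ⧸ LinearMap.range f) fun I i hi => by
      have hJ : ExtVanishes R (R ⧸ I) J i :=
        HasInjectiveDimensionLT.subsingleton J 1 i (by omega) _
      exact .of_shift_target hf (Submodule.mkQ_surjective _) hex hJ (h I (i + 1) (by omega))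
    exact (shortExact_of_linearMap hf (Submodule.mkQ_surjective _)
      hex).hasInjectiveDimensionLT_X₁ (n + 1) hC
      (hasInjectiveDimensionLT_of_ge J 1 _ (by omega))

section Cyclic

variable {I J : Ideal R} {x : R}

lemma mapQ_lsmul_injective (hJ : ∀ r, r ∈ J ↔ x * r ∈ I) :
    Function.Injective (Submodule.mapQ J I (LinearMap.lsmul R R x) fun r hr => (hJ r).1 hr) := by
  rw [injective_iff_map_eq_zero]
  intro a
  obtain ⟨a, rfl⟩ := Ideal.Quotient.mk_surjective a
  intro ha
  have : Ideal.Quotient.mk I (x * a) = 0 := ha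
  rw [Ideal.Quotient.eq_zero_iff_mem] at this ⊢
  exact (hJ a).2 this

lemma mapQ_lsmul_exact_factor {K : Ideal R} (hK : J ≤ Submodule.comap (LinearMap.lsmul R R x) I)
    (hIK : I ≤ K) (hxK : x ∈ K) (hK' : K ≤ I ⊔ Ideal.span {x}) :
    Function.Exact (Submodule.mapQ J I (LinearMap.lsmul R R x) hK) (Submodule.factor hIK) := by
  intro a
  obtain ⟨a, rfl⟩ := Ideal.Quotient.mk_surjective a
  change Ideal.Quotient.mk K a = 0 ↔ _
  rw [Ideal.Quotient.eq_zero_iff_mem]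
  constructor
  · intro ha
    obtain ⟨b, hb, c, hc, rfl⟩ := Submodule.mem_sup.1 (hK' ha)
    obtain ⟨d, rfl⟩ := Ideal.mem_span_singleton'.1 hc
    refine ⟨Ideal.Quotient.mk J d, ?_⟩
    change Ideal.Quotient.mk I (x * d) = _
    rw [map_add, Ideal.Quotient.eq_zero_iff_mem.2 hb, zero_add, mul_comm]
  · rintro ⟨d, hd⟩
    obtain ⟨d, rfl⟩ := Ideal.Quotient.mk_surjective d
    have hd' : Ideal.Quotient.mk I (x * d) = Ideal.Quotient.mk I a := hd
    rw [Ideal.Quotient.eq] at hd'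
    have := K.sub_mem (K.mul_mem_right d hxK) (hIK hd')
    simpa using this

end Cyclic

variable [IsLocalRing R] [IsNoetherianRing R]

open IsLocalRing

/-- Since `x` is regular on `R ⧸ p`, the long exact sequence makes multiplication by `x` surjective
on the finite module `Ext^i(R/p, M)`, and Nakayama kills it. -/
lemma extVanishes_of_prime {M : Type u} [AddCommGroup M] [Module R M] [Module.Finite R M] {i : ℕ}
    {p : Ideal R} {x : R} (hp : p.IsPrime) (hx : x ∈ maximalIdeal R) (hxp : x ∉ p)
    (h : ExtVanishes R (R ⧸ (p ⊔ Ideal.span {x})) M (i + 1)) : ExtVanishes R (R ⧸ p) M i := by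
  have hcolon (r : R) : r ∈ p ↔ x * r ∈ p :=
    ⟨fun hr => p.mul_mem_left x hr, fun hr => (hp.mem_or_mem hr).resolve_left hxp⟩
  have hse := shortExact_of_linearMap (mapQ_lsmul_injective hcolon) (Submodule.factor_surjective _)
    (mapQ_lsmul_exact_factor (K := p ⊔ Ideal.span {x}) (fun r hr => (hcolon r).1 hr) le_sup_left
      (Ideal.mem_sup_right (Ideal.mem_span_singleton_self x)) le_rfl)
  have hsurj : ∀ e : Abelian.Ext.{u} (ModuleCat.of R (R ⧸ p)) (ModuleCat.of R M) i,
      ∃ y, x • y = e := by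
    intro e
    obtain ⟨y, hy⟩ := Abelian.Ext.contravariant_sequence_exact₁ hse _ e (add_comm 1 i)
      (h.elim _ _)
    refine ⟨y, ?_⟩
    have hsm : ModuleCat.ofHom (Submodule.mapQ p p (LinearMap.lsmul R R x)
        fun r hr => (hcolon r).1 hr) = x • 𝟙 (ModuleCat.of R (R ⧸ p)) := by
      refine ModuleCat.hom_ext (LinearMap.ext fun a => ?_)
      obtain ⟨a, rfl⟩ := Ideal.Quotient.mk_surjective a
      rfl
    have hy' : (Abelian.Ext.mk₀ (ModuleCat.ofHom (Submodule.mapQ p p (LinearMap.lsmul R R x)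
        fun r hr => (hcolon r).1 hr))).comp y (zero_add i) = e := hy
    rw [hsm, Abelian.Ext.mk₀_smul, Abelian.Ext.smul_comp, Abelian.Ext.mk₀_id_comp] at hy'
    exact hy'
  have hfin : Module.Finite R
    (Abelian.Ext.{u} (ModuleCat.of R (R ⧸ p)) (ModuleCat.of R M) i) :=
      ModuleCat.finite_ext R (ModuleCat.of R (R ⧸ p)) (ModuleCat.of R M) i
  have hbot : (⊤ : Submodule R
      (Abelian.Ext.{u} (ModuleCat.of R (R ⧸ p)) (ModuleCat.of R M) i)) = ⊥ := by
    refine Submodule.eq_bot_of_le_smul_of_le_jacobson_bot (maximalIdeal R) _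
      Module.Finite.fg_top ?_ (maximalIdeal_le_jacobson ⊥)
    intro e _
    obtain ⟨y, rfl⟩ := hsurj e
    exact Submodule.smul_mem_smul hx trivial
  exact (Submodule.subsingleton_iff R).1 (subsingleton_of_bot_eq_top hbot.symm)

lemma extVanishes_of_residueField {M : Type u} [AddCommGroup M] [Module R M] [Module.Finite R M]
    {n : ℕ} (h : ∀ i, n ≤ i → ExtVanishes R (R ⧸ maximalIdeal R) M i) (I : Ideal R) :
    ∀ i, n ≤ i → ExtVanishes R (R ⧸ I) M i := by
  induction I using WellFoundedGT.induction with
  | ind I ih =>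
  intro i hi
  by_cases htop : I = ⊤
  · have : Subsingleton (R ⧸ I) := Ideal.Quotient.subsingleton_iff.2 htop
    exact .of_subsingleton i
  by_cases hI : I.IsPrime
  · by_cases hmax : I = maximalIdeal R
    · subst hmax
      exact h i hi
    obtain ⟨x, hx, hxI⟩ := SetLike.exists_of_lt (lt_of_le_of_ne (le_maximalIdeal htop) hmax)
    refine extVanishes_of_prime hI hx hxI (ih _ ?_ _ (by omega))
    exact left_lt_sup.2 fun hle => hxI (hle (Ideal.mem_span_singleton_self x))
  · obtain ⟨a, ha, b, hb, hab⟩ := (Ideal.not_isPrime_iff.1 hI).resolve_left htop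
    -- With `ab ∈ I`, use `0 → R/(I : a) → R/I → R/(I + (a)) → 0`; both outer ideals are strictly
    -- larger, containing `b` and `a` respectively.
    have hle : I ≤ Submodule.comap (LinearMap.lsmul R R a) I := fun r hr => I.mul_mem_left a hr
    refine .middle (mapQ_lsmul_injective (J := Submodule.comap (LinearMap.lsmul R R a) I)
      (fun r => Iff.rfl)) (Submodule.factor_surjective le_sup_left)
      (mapQ_lsmul_exact_factor (K := I ⊔ Ideal.span {a}) le_rfl le_sup_left
        (Ideal.mem_sup_right (Ideal.mem_span_singleton_self a)) le_rfl)
      (ih _ (lt_of_le_of_ne hle fun heq => hb ?_) i hi) (ih _ ?_ i hi)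
    · rw [heq]
      exact hab
    · exact left_lt_sup.2 fun hle => ha (hle (Ideal.mem_span_singleton_self a))

lemma isGorensteinLocalRing_of_extVanishes {n : ℕ}
    (h : ∀ i, n ≤ i → ExtVanishes R (R ⧸ maximalIdeal R) R i) : IsGorensteinLocalRing R :=
  lt_of_lt_of_le (injectiveDimension_lt_iff.2 (hasInjectiveDimensionLT_of_extVanishes n R
    fun I i hi => extVanishes_of_residueField h I i (by omega))) le_top

lemma IsGorensteinLocalRing.exists_extVanishes (h : IsGorensteinLocalRing R) :
    ∃ n : ℕ, ∀ (N : Type u) [AddCommGroup N] [Module R N], ∀ i, n < i → ExtVanishes R N R i := by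
  obtain ⟨n, hn⟩ := (injectiveDimension_ne_top_iff _).1 (ne_top_of_lt h)
  exact ⟨n, fun N _ _ i hi => HasInjectiveDimensionLT.subsingleton _ (n + 1) i hi _⟩

end InjectiveDimension

/-! ### Integrally closed ideals and the Burch property. -/

section Burch

open IsLocalRing

variable {R : Type u} [CommRing R]

/-- Determinant trick for multiplication by `y` on `N`. As `N` need not be faithful, the resulting
relation `p(y) = 0` on `N` is evaluated at `y ∈ N`, giving `p(y) y = 0`: degree one higher, constant
term zero. -/
lemma isIntegralOverIdeal_of_mul_mem {I N : Ideal R} (hN : N.FG) {y : R} (hy : y ∈ N)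
    (h : ∀ z ∈ N, y * z ∈ I * N) : IsIntegralOverIdeal I y := by
  have : Module.Finite R N := Module.Finite.iff_fg.2 hN
  obtain ⟨p, hmonic, -, hcoeff, hp⟩ :=
    LinearMap.exists_monic_and_natDegree_eq_and_coeff_mem_pow_and_aeval_eq_zero R
      (LinearMap.lsmul R N y) I (by
        rintro _ ⟨z, rfl⟩
        obtain ⟨w, hw, hwz⟩ : y * z ∈ (I • (⊤ : Submodule R N)).map N.subtype := by
          simpa [Submodule.map_smul''] using h z z.2
        obtain rfl : w = y • z := Subtype.ext hwz
        exact hw)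
  have hev : p.eval y * y = 0 := by
    have := congrArg (Subtype.val) (LinearMap.congr_fun hp ⟨y, hy⟩)
    have halg : LinearMap.lsmul R N y = algebraMap R (Module.End R N) y := rfl
    rw [halg, Polynomial.aeval_algebraMap_apply] at this
    simpa using this
  refine ⟨p.natDegree + 1, by omega, fun i => if i ≤ p.natDegree then p.coeff (p.natDegree - i)
    else 0, ?_, ?_⟩
  · intro i hi
    dsimp only
    split_ifs with h'
    · simpa [Nat.sub_sub_self h'] using hcoeff (p.natDegree - i)
    · exact zero_mem _
  · refine Eq.trans ?_ hev
    rw [Polynomial.eval_eq_sum_range, Finset.sum_mul]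
    dsimp only
    have hIcc : Finset.Icc 1 (p.natDegree + 1) = Finset.Ico 1 (p.natDegree + 2) := by
      ext
      simp only [Finset.mem_Icc, Finset.mem_Ico]
      omega
    rw [hIcc, Finset.sum_Ico_eq_sum_range, show p.natDegree + 2 - 1 = p.natDegree + 1 from rfl,
      Finset.sum_range_succ, Finset.sum_range_succ, hmonic.coeff_natDegree,
      ← Finset.sum_range_reflect, if_neg (by omega), zero_mul, add_zero, one_mul, ← pow_succ,
      add_comm]
    refine congrArg (· + y ^ (p.natDegree + 1)) (Finset.sum_congr rfl fun i hi => ?_)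
    have hi := Finset.mem_range.1 hi
    rw [if_pos (by omega), mul_assoc, ← pow_succ,
      show p.natDegree - (1 + (p.natDegree - 1 - i)) = i by omega,
      show p.natDegree + 1 - (1 + (p.natDegree - 1 - i)) = i + 1 by omega]

variable [IsLocalRing R] [IsNoetherianRing R]

/-- Integrally closed primary ideals of the maximal ideal are Burch ideals. -/
lemma exists_mul_notMem_maximalIdeal_mul {I : Ideal R} (hclosed : IsIntegrallyClosedIdeal I)
    (hradical : I.radical = maximalIdeal R) (hne : I ≠ maximalIdeal R) :
    ∃ x ∈ maximalIdeal R, ∃ y : R, (∀ z ∈ maximalIdeal R, y * z ∈ I) ∧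
      x * y ∉ maximalIdeal R * I := by
  classical
  have hle : I ≤ maximalIdeal R := hradical ▸ Ideal.le_radical
  have hpow : ∃ n, maximalIdeal R ^ n ≤ I := by
    rw [← hradical]
    exact I.exists_radical_pow_le_of_fg (IsNoetherian.noetherian _)
  -- A socle element of `R ⧸ I`, taken from the last power of `m` not contained in `I`.
  obtain ⟨y, hy, hyI⟩ : ∃ y, (∀ z ∈ maximalIdeal R, y * z ∈ I) ∧ y ∉ I := by
    have hspec := Nat.find_spec hpow
    have hmin := fun m => @Nat.find_min _ _ hpow m
    generalize Nat.find hpow = n at hspec hmin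
    obtain _ | n := n
    · rw [pow_zero, Ideal.one_eq_top, top_le_iff] at hspec
      exact absurd (hspec ▸ hle) (fun h => (maximalIdeal.isMaximal R).ne_top (top_le_iff.1 h))
    · obtain ⟨y, hy, hyI⟩ := SetLike.not_le_iff_exists.1 (hmin n (Nat.lt_succ_self n))
      exact ⟨y, fun z hz => hspec (pow_succ (maximalIdeal R) n ▸ Ideal.mul_mem_mul hy hz), hyI⟩
  have hym : y ∈ maximalIdeal R := by
    by_contra hunit
    have hunit : IsUnit y := by simpa using hunit
    refine hne (le_antisymm hle fun z hz => ?_)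
    exact (Ideal.unit_mul_mem_iff_mem I hunit).1 (hy z hz)
  -- Otherwise `y m ⊆ I m`, so `y` is integral over `I` and hence in `I`.
  by_contra! hcon
  refine hyI (hclosed y (isIntegralOverIdeal_of_mul_mem (N := maximalIdeal R)
    (IsNoetherian.noetherian _) hym fun z hz => ?_))
  rw [mul_comm y, mul_comm I]
  exact hcon z hz y hy

/-- `J` is the preimage of a hyperplane of the `k`-vector space `I/mI` missing the class of `w`. -/
lemma exists_maximal_avoiding {I : Ideal R} {w : R} (hwI : w ∈ I) (hw : w ∉ maximalIdeal R * I) :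
    ∃ J : Ideal R, maximalIdeal R * I ≤ J ∧ J ≤ I ∧ w ∉ J ∧ I ≤ J ⊔ Ideal.span {w} := by
  obtain ⟨J, ⟨hmJ, hJI, hwJ⟩, hmax⟩ := set_has_maximal_iff_noetherian.2 ‹IsNoetherianRing R›
    {J : Ideal R | maximalIdeal R * I ≤ J ∧ J ≤ I ∧ w ∉ J} ⟨_, le_rfl, Ideal.mul_le_right, hw⟩
  refine ⟨J, hmJ, hJI, hwJ, fun a ha => ?_⟩
  by_cases haJ : a ∈ J
  · exact Ideal.mem_sup_left haJ
  have hlt : J < J ⊔ Ideal.span {a} :=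
    left_lt_sup.2 fun hle => haJ (hle (Ideal.mem_span_singleton_self a))
  have hwmem : w ∈ J ⊔ Ideal.span {a} := by
    by_contra hcon
    exact hmax _ ⟨hmJ.trans le_sup_left, sup_le hJI (by simpa [Ideal.span_le] using ha), hcon⟩ hlt
  obtain ⟨j, hj, c, hc, rfl⟩ := Submodule.mem_sup.1 hwmem
  obtain ⟨r, rfl⟩ := Ideal.mem_span_singleton'.1 hc
  have hr : IsUnit r := by
    by_contra hr
    exact hwJ (J.add_mem hj (hmJ (Ideal.mul_mem_mul ((mem_maximalIdeal r).2 hr) ha)))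
  refine (Ideal.unit_mul_mem_iff_mem _ hr).1 ?_
  have := Ideal.sub_mem (J ⊔ Ideal.span {j + r * a})
    (Ideal.mem_sup_right (Ideal.mem_span_singleton_self _)) (Ideal.mem_sup_left hj)
  simpa using this

lemma extVanishes_residueField_of_extVanishes_quotient {I : Ideal R}
    (hclosed : IsIntegrallyClosedIdeal I) (hradical : I.radical = maximalIdeal R)
    {M : Type u} [AddCommGroup M] [Module R M] {i : ℕ} (hi : ExtVanishes R (R ⧸ I) M i)
    (hi' : ExtVanishes R (R ⧸ I) M (i + 1)) : ExtVanishes R (R ⧸ maximalIdeal R) M i := by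
  by_cases hne : I = maximalIdeal R
  · subst hne
    exact hi
  obtain ⟨x, hx, y, hy, hxy⟩ := exists_mul_notMem_maximalIdeal_mul hclosed hradical hne
  have hxyI : x * y ∈ I := mul_comm x y ▸ hy x hx
  obtain ⟨J, hmJ, hJI, hxyJ, hIJ⟩ := exists_maximal_avoiding hxyI hxy
  -- `v ∘ₗ u` is multiplication by `xy`, which identifies `k` with `I/J`.
  let u : (R ⧸ maximalIdeal R) →ₗ[R] R ⧸ I := Submodule.mapQ _ _ (LinearMap.lsmul R R y) hy
  let v : (R ⧸ I) →ₗ[R] R ⧸ J := Submodule.mapQ _ _ (LinearMap.lsmul R R x)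
    fun a ha => hmJ (Ideal.mul_mem_mul hx ha)
  have hcolon (r : R) : r ∈ maximalIdeal R ↔ x * y * r ∈ J := by
    refine ⟨fun hr => hmJ (mul_comm r (x * y) ▸ Ideal.mul_mem_mul hr hxyI), fun hr => ?_⟩
    by_contra hunit
    exact hxyJ ((Ideal.mul_unit_mem_iff_mem J (by simpa using hunit)).1 hr)
  have hvu : v ∘ₗ u = Submodule.mapQ (maximalIdeal R) J (LinearMap.lsmul R R (x * y))
      fun r hr => (hcolon r).1 hr := by
    ext
    change Ideal.Quotient.mk J _ = Ideal.Quotient.mk J _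
    simp
  refine .of_factor (u := u) (v := v) (g := Submodule.factor hJI) ?_
    (Submodule.factor_surjective hJI) ?_ hi hi'
  · rw [hvu]
    exact mapQ_lsmul_injective hcolon
  · rw [hvu]
    exact mapQ_lsmul_exact_factor _ hJI hxyI hIJ

end Burch

/-! ### Dualizing short exact sequences. -/

section DualSequence

variable {R : Type u} [CommRing R]
variable {A B C : Type u} [AddCommGroup A] [Module R A] [AddCommGroup B] [Module R B]
  [AddCommGroup C] [Module R C] {f : A →ₗ[R] B} {g : B →ₗ[R] C}

lemma dualMap_exact (hg : Function.Surjective g) (h : Function.Exact f g) :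
    Function.Exact g.dualMap f.dualMap := by
  intro φ
  constructor
  · intro hφ
    have hker : LinearMap.ker g ≤ LinearMap.ker φ := fun x hx => by
      obtain ⟨a, rfl⟩ := (h x).1 hx
      exact LinearMap.congr_fun hφ a
    refine ⟨(LinearMap.ker g).liftQ φ hker ∘ₗ (g.quotKerEquivOfSurjective hg).symm, ?_⟩
    ext x
    have : (g.quotKerEquivOfSurjective hg).symm (g x) = (LinearMap.ker g).mkQ x := by
      rw [LinearEquiv.symm_apply_eq]
      rfl
    simp [this]
  · rintro ⟨ψ, rfl⟩
    ext a
    simp [h.apply_apply_eq_zero]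

lemma ExtVanishes.dualMap_surjective (hf : Function.Injective f) (hg : Function.Surjective g)
    (h : Function.Exact f g) (hC : ExtVanishes R C R 1) : Function.Surjective f.dualMap :=
  fun φ => hC.exists_extension hf hg h φ

end DualSequence

/-! ### Gorenstein dimension and vanishing of Ext. -/

section GorensteinDimension

variable {R : Type u} [CommRing R]

lemma exact_zero_left {A B C : Type u} [AddCommGroup A] [Module R A] [AddCommGroup B] [Module R B]
    [AddCommGroup C] [Module R C] [Subsingleton A] {d : A →ₗ[R] B} {ε : B →ₗ[R] C}
    (h : Function.Exact d ε) : Function.Injective ε := by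
  rw [injective_iff_map_eq_zero]
  intro b hb
  obtain ⟨a, rfl⟩ := (h b).1 hb
  rw [Subsingleton.elim a 0, map_zero]

lemma HasGResolutionOfLength.extVanishes {n : ℕ} {M : Type u} [AddCommGroup M] [Module R M]
    (h : HasGResolutionOfLength R M n) : ∀ i, n < i → ExtVanishes R M R i := by
  induction n generalizing M with
  | zero =>
    intro i hi
    obtain ⟨G, d, ε, hG, hzero, hε, hd, -⟩ := h
    have := hzero 1 one_pos
    exact .of_linearEquiv (LinearEquiv.ofBijective ε ⟨exact_zero_left hd, hε⟩)
      ((hG 0).ext_self i hi)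
  | succ n ih =>
    intro i hi
    obtain ⟨G, d, ε, hG, hzero, hε, hd, hexact⟩ := h
    obtain ⟨i, rfl⟩ : ∃ j, i = j + 1 := ⟨i - 1, by omega⟩
    -- Truncating the resolution resolves the first syzygy, one step shorter.
    have hK : HasGResolutionOfLength R (LinearMap.ker ε) n := by
      refine ⟨fun j => G (j + 1), fun j => d (j + 1),
        (d 0).codRestrict _ fun x => hd.apply_apply_eq_zero x, fun j => hG _,
        fun j hj => hzero _ (by omega), ?_, ?_, fun j => hexact _⟩
      · rintro ⟨x, hx⟩
        obtain ⟨y, rfl⟩ := (hd x).1 hx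
        exact ⟨y, rfl⟩
      · intro x
        rw [← hexact 0 x]
        exact Subtype.ext_iff
    exact .right (LinearMap.ker ε).injective_subtype hε (LinearMap.exact_subtype_ker_map ε)
      (ih hK i (by omega)) ((hG 0).ext_self _ (by omega))

lemma gorensteinDimension_lt_top_iff {M : Type u} [AddCommGroup M] [Module R M] :
    gorensteinDimension R M < ⊤ ↔ Subsingleton M ∨ ∃ n, HasGResolutionOfLength R M n := by
  unfold gorensteinDimension
  split_ifs with h
  · simp [h]
  · simp only [h, false_or, iInf_lt_iff]
    exact ⟨fun ⟨n, hn, _⟩ => ⟨n, hn⟩, fun ⟨n, hn⟩ => ⟨n, hn, WithBot.coe_lt_coe.2 (by simp)⟩⟩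

lemma exists_extVanishes_of_gorensteinDimension_lt_top {M : Type u} [AddCommGroup M] [Module R M]
    (h : gorensteinDimension R M < ⊤) : ∃ n : ℕ, ∀ i, n < i → ExtVanishes R M R i := by
  obtain h | ⟨n, hn⟩ := gorensteinDimension_lt_top_iff.1 h
  · exact ⟨0, fun i _ => .of_subsingleton i⟩
  · exact ⟨n, hn.extVanishes⟩

lemma ExtVanishes.ker_of_free_cover {m : ℕ} {M N : Type u} [AddCommGroup M] [Module R M]
    [AddCommGroup N] [Module R N] {g : (Fin m → R) →ₗ[R] M} (hg : Function.Surjective g) {i : ℕ}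
    (hi : 1 ≤ i) (h : ExtVanishes R M N (i + 1)) : ExtVanishes R (LinearMap.ker g) N i := by
  obtain ⟨j, rfl⟩ : ∃ j, i = j + 1 := ⟨i - 1, by omega⟩
  exact .left (LinearMap.ker g).injective_subtype hg (LinearMap.exact_subtype_ker_map g)
    (.of_projective j) h

/-! ### Total reflexivity over rings of finite self-injective dimension. -/

section FiniteInjectiveDimension

variable [IsNoetherianRing R] {n : ℕ}

lemma exists_free_cover (M : Type u) [AddCommGroup M] [Module R M] [Module.Finite R M] :
    ∃ (m : ℕ) (g : (Fin m → R) →ₗ[R] M), Function.Surjective g ∧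
      Module.Finite R (LinearMap.ker g) :=
  have ⟨m, g, hg⟩ := Module.Finite.exists_fin' R M
  ⟨m, g, hg, inferInstance⟩

lemma ExtVanishes.dual
    (hR : ∀ (N : Type u) [AddCommGroup N] [Module R N], ∀ i, n < i → ExtVanishes R N R i)
    {M : Type u} [AddCommGroup M] [Module R M] [Module.Finite R M]
    (hM : ∀ i, 1 ≤ i → ExtVanishes R M R i) :
    ∀ i, 1 ≤ i → ExtVanishes R (Module.Dual R M) R i := by
  -- For a syzygy `K` of `M` with free cover `F`, `Ext^1(M, R) = 0` makes `0 → M* → F* → K* → 0`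
  -- exact, so degree `i` for `M*` reduces to degree `i + 1` for `K*`. Here `k` bounds the number of
  -- shifts needed to exceed `n`.
  suffices H : ∀ (k : ℕ) {M : Type u} [AddCommGroup M] [Module R M] [Module.Finite R M],
      (∀ i, 1 ≤ i → ExtVanishes R M R i) → ∀ i, 1 ≤ i → n < i + k →
        ExtVanishes R (Module.Dual R M) R i from
    fun i hi => H n hM i hi (by omega)
  intro k
  induction k with
  | zero => exact fun {M} _ _ _ hM i _ hi => hR _ i hi
  | succ k ih =>
    intro M _ _ _ hM i hi hik
    obtain ⟨m, g, hg, hfin⟩ := exists_free_cover (R := R) M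
    have hinj := (LinearMap.ker g).injective_subtype
    have hex := LinearMap.exact_subtype_ker_map g
    have hK : ∀ i, 1 ≤ i → ExtVanishes R (LinearMap.ker g) R i := fun i hi =>
      .ker_of_free_cover hg hi (hM _ (by omega))
    obtain ⟨j, rfl⟩ : ∃ j, i = j + 1 := ⟨i - 1, by omega⟩
    exact .left (LinearMap.dualMap_injective_of_surjective hg)
      ((hM 1 le_rfl).dualMap_surjective hinj hg hex) (dualMap_exact hg hex)
      (.of_projective j) (ih hK (j + 1 + 1) (by omega) (by omega))

/-- `Ext^1(K*, R) = 0` for the syzygy `K`, so `F** → M**` is onto; `F` is reflexive and biduality is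
natural. -/
lemma dual_eval_surjective_of_extVanishes
    (hR : ∀ (N : Type u) [AddCommGroup N] [Module R N], ∀ i, n < i → ExtVanishes R N R i)
    {M : Type u} [AddCommGroup M] [Module R M] [Module.Finite R M]
    (hM : ∀ i, 1 ≤ i → ExtVanishes R M R i) :
    Function.Surjective (Module.Dual.eval R M) := by
  obtain ⟨m, g, hg, hfin⟩ := exists_free_cover (R := R) M
  have hinj := (LinearMap.ker g).injective_subtype
  have hex := LinearMap.exact_subtype_ker_map g
  have hK : ∀ i, 1 ≤ i → ExtVanishes R (LinearMap.ker g) R i := fun i hi =>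
    .ker_of_free_cover hg hi (hM _ (by omega))
  have hsurj : Function.Surjective g.dualMap.dualMap :=
    (ExtVanishes.dual hR hK 1 le_rfl).dualMap_surjective
      (LinearMap.dualMap_injective_of_surjective hg)
      ((hM 1 le_rfl).dualMap_surjective hinj hg hex) (dualMap_exact hg hex)
  intro φ
  obtain ⟨ψ, rfl⟩ := hsurj φ
  obtain ⟨x, rfl⟩ := (Module.bijective_dual_eval R (Fin m → R)).2 ψ
  exact ⟨g x, rfl⟩

/-- If the image of `x ∈ F` dies in `M**`, exactness of `K** → F** → M**` and surjectivity of
biduality for `K` put `x` in `K`. -/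
lemma dual_eval_injective_of_extVanishes
    (hR : ∀ (N : Type u) [AddCommGroup N] [Module R N], ∀ i, n < i → ExtVanishes R N R i)
    {M : Type u} [AddCommGroup M] [Module R M] [Module.Finite R M]
    (hM : ∀ i, 1 ≤ i → ExtVanishes R M R i) :
    Function.Injective (Module.Dual.eval R M) := by
  obtain ⟨m, g, hg, hfin⟩ := exists_free_cover (R := R) M
  have hinj := (LinearMap.ker g).injective_subtype
  have hex := LinearMap.exact_subtype_ker_map g
  have hK : ∀ i, 1 ≤ i → ExtVanishes R (LinearMap.ker g) R i := fun i hi =>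
    .ker_of_free_cover hg hi (hM _ (by omega))
  have hexdual := dualMap_exact ((hM 1 le_rfl).dualMap_surjective hinj hg hex)
    (dualMap_exact hg hex)
  rw [injective_iff_map_eq_zero]
  intro a ha
  obtain ⟨x, rfl⟩ := hg a
  obtain ⟨κ, hκ⟩ := (hexdual (Module.Dual.eval R _ x)).1 ha
  obtain ⟨k, rfl⟩ := dual_eval_surjective_of_extVanishes hR hK κ
  have hxk : (k : Fin m → R) = x := (Module.bijective_dual_eval R (Fin m → R)).1 hκ
  exact hxk ▸ k.2

lemma isTotallyReflexive_of_extVanishes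
    (hR : ∀ (N : Type u) [AddCommGroup N] [Module R N], ∀ i, n < i → ExtVanishes R N R i)
    {M : Type u} [AddCommGroup M] [Module R M] [Module.Finite R M]
    (hM : ∀ i, 1 ≤ i → ExtVanishes R M R i) : IsTotallyReflexive R M where
  finite := inferInstance
  reflexive := ⟨dual_eval_injective_of_extVanishes hR hM, dual_eval_surjective_of_extVanishes hR hM⟩
  ext_self := hM
  ext_dual := ExtVanishes.dual hR hM

/-- Free covers are peeled off `k` times; the last syzygy has no positive Ext into `R`, so it is
totally reflexive. -/
lemma hasGResolutionOfLength_of_extVanishes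
    (hR : ∀ (N : Type u) [AddCommGroup N] [Module R N], ∀ i, n < i → ExtVanishes R N R i)
    (k : ℕ) {M : Type u} [AddCommGroup M] [Module R M] [Module.Finite R M]
    (hM : ∀ i, k < i → ExtVanishes R M R i) : HasGResolutionOfLength R M k := by
  have htriv : IsTotallyReflexive R PUnit.{u + 1} :=
    isTotallyReflexive_of_extVanishes hR fun i _ => .of_subsingleton i
  induction k generalizing M with
  | zero =>
    refine ⟨fun i => Nat.casesOn i (ModuleCat.of R M) fun _ => ModuleCat.of R PUnit.{u + 1},
      fun _ => 0, LinearMap.id, ?_, ?_, fun x => ⟨x, rfl⟩, ?_, fun i x => ?_⟩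
    · rintro (_ | i)
      · exact isTotallyReflexive_of_extVanishes hR hM
      · exact htriv
    · rintro (_ | i) hi
      · omega
      · exact inferInstanceAs (Subsingleton PUnit)
    · intro x
      exact ⟨fun hx => ⟨0, by simpa using hx.symm⟩, fun ⟨_, hx⟩ => hx.symm⟩
    · have : Subsingleton PUnit.{u + 1} := inferInstance
      exact ⟨fun _ => ⟨0, this.elim _ _⟩, fun _ => rfl⟩
  | succ k ih =>
    obtain ⟨m, g, hg, hfin⟩ := exists_free_cover (R := R) M
    obtain ⟨G, d, ε, hG, hzero, hε, hd, hexact⟩ := ih (M := LinearMap.ker g) fun i hi =>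
      .ker_of_free_cover hg (by omega) (hM _ (by omega))
    have hF : IsTotallyReflexive R (Fin m → R) :=
      isTotallyReflexive_of_extVanishes hR fun i hi => by
        obtain ⟨j, rfl⟩ : ∃ j, i = j + 1 := ⟨i - 1, by omega⟩
        exact .of_projective j
    refine ⟨fun i => Nat.casesOn i (ModuleCat.of R (Fin m → R)) G,
      fun i => Nat.casesOn i ((LinearMap.ker g).subtype ∘ₗ ε) d, g, ?_, ?_, hg, ?_, ?_⟩
    · rintro (_ | i)
      · exact hF
      · exact hG i
    · rintro (_ | i) hi
      · omega
      · exact hzero i (by omega)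
    · intro x
      refine ⟨fun hx => ?_, ?_⟩
      · obtain ⟨y, hy⟩ := hε ⟨x, hx⟩
        exact ⟨y, congrArg Subtype.val hy⟩
      · rintro ⟨y, rfl⟩
        exact (ε y).2
    · rintro (_ | i)
      · intro x
        exact Iff.trans (Submodule.coe_eq_zero (p := LinearMap.ker g)) (hd x)
      · exact hexact i

end FiniteInjectiveDimension

lemma IsGorensteinLocalRing.gorensteinDimension_lt_top [IsLocalRing R] [IsNoetherianRing R]
    (h : IsGorensteinLocalRing R) (M : Type u) [AddCommGroup M] [Module R M] [Module.Finite R M] :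
    gorensteinDimension R M < ⊤ := by
  obtain ⟨n, hn⟩ := h.exists_extVanishes
  exact gorensteinDimension_lt_top_iff.2
    (.inr ⟨n, hasGResolutionOfLength_of_extVanishes hn n (hn M)⟩)

end GorensteinDimension

lemma isGorensteinLocalRing_of_extVanishes_quotient {R : Type u} [CommRing R]
    [IsLocalRing R] [IsNoetherianRing R] {I : Ideal R} (hclosed : IsIntegrallyClosedIdeal I)
    (hradical : I.radical = IsLocalRing.maximalIdeal R) {n : ℕ}
    (h : ∀ i, n < i → ExtVanishes R (R ⧸ I) R i) : IsGorensteinLocalRing R :=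
  isGorensteinLocalRing_of_extVanishes (n := n + 1) fun i hi =>
    extVanishes_residueField_of_extVanishes_quotient hclosed hradical (h i (by omega))
      (h (i + 1) (by omega))

theorem mainTheorem5 {R : Type u} [CommRing R] [IsLocalRing R] [IsNoetherianRing R]
    (I : Ideal R) (hclosed : IsIntegrallyClosedIdeal I)
    (hprimary : I.IsPrimary) (hradical : I.radical = IsLocalRing.maximalIdeal R) :
    (IsGorensteinLocalRing R ↔ gorensteinDimension R I < ⊤) ∧
      (gorensteinDimension R I < ⊤ ↔ gorensteinDimension R (R ⧸ I) < ⊤) := by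
  have hquot : gorensteinDimension R (R ⧸ I) < ⊤ → IsGorensteinLocalRing R := fun h => by
    obtain ⟨n, hn⟩ := exists_extVanishes_of_gorensteinDimension_lt_top h
    exact isGorensteinLocalRing_of_extVanishes_quotient hclosed hradical hn
  have hideal : gorensteinDimension R I < ⊤ → IsGorensteinLocalRing R := fun h => by
    obtain ⟨n, hn⟩ := exists_extVanishes_of_gorensteinDimension_lt_top h
    -- As `R` is free, vanishing for `I` passes to `R ⧸ I` one degree higher, hence the bound `n +
    -- 1`.
    refine isGorensteinLocalRing_of_extVanishes_quotient hclosed hradical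
      (n := n + 1) fun i hi => ?_
    obtain ⟨j, rfl⟩ : ∃ j, i = j + 1 := ⟨i - 1, by omega⟩
    exact .right I.injective_subtype I.mkQ_surjective (LinearMap.exact_subtype_mkQ I)
      (hn j (by omega)) (.of_projective j)
  exact ⟨⟨fun h => h.gorensteinDimension_lt_top I, hideal⟩,
    fun h => (hideal h).gorensteinDimension_lt_top _,
    fun h => (hquot h).gorensteinDimension_lt_top _⟩
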